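/- Let $\mathcal F_0$ be the triangle (the complete graph on three nodes) and, for $g\ge 0$, let $\mathcal F_{g+1}$ be obtained from $\mathcal F_g$ by keeping all its nodes and edges and adding, for each edge of $\mathcal F_g$, one new node joined to both end nodes of this edge. The graph $\mathcal F_g$ is called the pseudofractal scale-free web after $g$ iterations; let $N_g$ be its number of nodes. For a finite connected simple graph $\mathcal G$ with at least two nodes, consider the random walk that at each time step moves to a uniformly chosen neighbour of its current location, and let the cover time $C(\mathcal G)$ be the maximum, over all starting nodes $u$, of the expected number of steps that the walk started at $u$ needs to visit every node of $\mathcal G$. Theorem. For every $g\ge 0$, $N_g = 3(3^g+1)/2$, and $C(\mathcal F_g)=\Theta(N_g\log N_g)$; that is, there are real constants $c_1, c_2>0$, independent of $g$, such that for every $g\ge 0$ $$ c_1\,N_g\log N_g \;\le\; C(\mathcal F_g)\;\le\; c_2\,N_g\log N_g .$$ -/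

import Mathlib

open MeasureTheory ProbabilityTheory
open scoped ENNReal

noncomputable section

/-! ## Cover time of the simple random walk -/

namespace RandomWalk

variable {V : Type*} [MeasurableSpace V] [DiscreteMeasurableSpace V] [Finite V]

/-- One step of the simple random walk on `G`: the walker at `v` moves to a uniformly chosen
neighbour of `v` (an isolated vertex, which does not occur in a connected graph with at least two
vertices, is absorbing). -/
def step (G : SimpleGraph V) : Kernel V V :=
  open Classical in
  { toFun := fun v =>
      if (G.neighborSet v).Nonempty then uniformOn (G.neighborSet v) else Measure.dirac v
    measurable' := measurable_of_countable _ }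

instance (G : SimpleGraph V) : IsMarkovKernel (step G) where
  isProbabilityMeasure v := by
    classical
    change IsProbabilityMeasure
      (if (G.neighborSet v).Nonempty then uniformOn (G.neighborSet v) else Measure.dirac v)
    split_ifs with h
    · exact isProbabilityMeasure_uniformOn (Set.toFinite _) h
    · infer_instance

/-- The transition from the history `(X₀, …, Xₙ)` to `Xₙ₊₁`: a step from the current
position `Xₙ`. -/
def historyStep (G : SimpleGraph V) (n : ℕ) :
    Kernel ((_ : Finset.Iic n) → V) V :=
  (step G).comap (fun x => x ⟨n, Finset.mem_Iic.2 le_rfl⟩) (measurable_pi_apply _)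

instance (G : SimpleGraph V) (n : ℕ) : IsMarkovKernel (historyStep G n) := by
  unfold historyStep; infer_instance

/-- The law, on the space `ℕ → V` of trajectories, of the simple random walk on `G` started
at `u`. -/
def law (G : SimpleGraph V) (u : V) : Measure (ℕ → V) :=
  Kernel.traj (X := fun _ => V) (historyStep G) 0 (fun _ => u)

/-- The number of steps after which the trajectory `ω` has visited every vertex
(`∞` if this never happens). -/
def stepsToCover (ω : ℕ → V) : ℝ≥0∞ :=
  ⨅ (t : ℕ) (_ : ∀ v : V, ∃ s ≤ t, ω s = v), (t : ℝ≥0∞)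

/-- The cover time from `u`: the expected number of steps that the simple random walk started
at `u` needs to visit every vertex. -/
def coverTimeFrom (G : SimpleGraph V) (u : V) : ℝ≥0∞ :=
  ∫⁻ ω, stepsToCover ω ∂(law G u)

/-- The cover time of `G`: the maximum over the starting vertices. -/
def coverTime (G : SimpleGraph V) : ℝ≥0∞ :=
  ⨆ u : V, coverTimeFrom G u

end RandomWalk

/-! ## The pseudofractal scale-free web -/

namespace Pseudofractal

/-- For each edge of `G`, one new vertex is created and joined to both ends of that edge; the old
edges are kept. -/
def grow {V : Type} (G : SimpleGraph V) : SimpleGraph (V ⊕ G.edgeSet) where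
  Adj
    | .inl u, .inl v => G.Adj u v
    | .inl u, .inr e => u ∈ (e : Sym2 V)
    | .inr e, .inl u => u ∈ (e : Sym2 V)
    | .inr _, .inr _ => False
  symm := ⟨by
    rintro (u | e) (v | f) h
    · exact G.adj_symm h
    · exact h
    · exact h
    · exact h⟩
  loopless := ⟨by
    rintro (u | e) h
    · exact G.irrefl h
    · exact h⟩

/-- The vertex set of the web after `g` iterations, together with the web itself: a triangle,
to which `grow` is applied `g` times. -/
def iterate : ℕ → Σ V : Type, SimpleGraph V
  | 0 => ⟨Fin 3, ⊤⟩
  | g + 1 => ⟨(iterate g).1 ⊕ (iterate g).2.edgeSet, grow (iterate g).2⟩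

/-- The vertices of the web after `g` iterations. -/
def Vertex (g : ℕ) : Type := (iterate g).1

/-- The pseudofractal scale-free web after `g` iterations. -/
def web (g : ℕ) : SimpleGraph (Vertex g) := (iterate g).2

instance instFiniteVertex (g : ℕ) : Finite (Vertex g) := by
  induction g with
  | zero => exact inferInstanceAs (Finite (Fin 3))
  | succ g ih =>
    have : Finite (iterate g).1 := ih
    exact inferInstanceAs (Finite ((iterate g).1 ⊕ (iterate g).2.edgeSet))

instance (g : ℕ) : MeasurableSpace (Vertex g) := ⊤

instance (g : ℕ) : DiscreteMeasurableSpace (Vertex g) := ⟨fun _ => trivial⟩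

end Pseudofractal

end

/-! The proof is Matthews' method. If every hitting time is at most `M`, the cover time is at most
`M` times a harmonic number of the number of nodes; if every vertex of a set `A` takes at least `m`
to hit from any other vertex, it is at least `m * harmonic (A.card - 1)`
(`coverTime_le_of_hittingTime_le`, `le_coverTime_of_le_hittingTime`). Both follow from a potential
whose expected drift, until covering, is at most, respectively at least, minus one per step.

Hitting times are never defined through the law of the walk. Matthews' argument uses only the
first-step equations, so any function satisfying `IsHittingTime` serves, and
`isHittingTime_growTime` gives an explicit one for `grow G` from one for `G`. By induction all
hitting times are at most `10 * 3 ^ g`, while for `g > 0` each of the `3 ^ g` newest vertices costs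
at least `3 ^ g` to hit (`exists_hittingTime`). As the number of nodes is of order `3 ^ g`, the
bounds agree up to a constant. -/

noncomputable section

namespace RandomWalk

/-! ### Cover time as a sum of survival indicators -/

section Trajectory

variable {V : Type*}

open Classical in
/-- The vertices of `A` that the trajectory `ω` has not visited up to time `n`. -/
def unvisited (A : Finset V) (ω : ℕ → V) (n : ℕ) : Finset V :=
  {v ∈ A | ∀ s ≤ n, ω s ≠ v}

open Classical in
/-- The vertices of `A` that do not occur in a history. -/
def missing (A : Finset V) (n : ℕ) (x : (_ : Finset.Iic n) → V) : Finset V :=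
  {v ∈ A | ∀ i, x i ≠ v}

lemma missing_frestrictLe (A : Finset V) (n : ℕ) (ω : ℕ → V) :
    missing A n (Preorder.frestrictLe n ω) = unvisited A ω n := by
  ext v
  simp only [missing, unvisited, Finset.mem_filter, Subtype.forall, Finset.mem_Iic]
  rfl

open Classical in
lemma unvisited_zero (A : Finset V) (ω : ℕ → V) : unvisited A ω 0 = A.erase (ω 0) := by
  ext v
  simp [unvisited, and_comm, eq_comm]

open Classical in
lemma unvisited_succ (A : Finset V) (ω : ℕ → V) (n : ℕ) :
    unvisited A ω (n + 1) = (unvisited A ω n).erase (ω (n + 1)) := by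
  ext v
  simp only [unvisited, Finset.mem_filter, Finset.mem_erase, Nat.le_succ_iff]
  constructor
  · rintro ⟨h, h'⟩
    exact ⟨(h' _ (Or.inr rfl)).symm, h, fun s hs => h' s (Or.inl hs)⟩
  · rintro ⟨h, h', h''⟩
    refine ⟨h', ?_⟩
    rintro s (hs | rfl)
    · exact h'' s hs
    · exact h.symm

lemma notMem_unvisited (A : Finset V) (ω : ℕ → V) (n : ℕ) : ω n ∉ unvisited A ω n := by
  simp only [unvisited, Finset.mem_filter, not_and, not_forall]
  exact fun _ => ⟨n, le_rfl, by simp⟩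

lemma unvisited_subset (A : Finset V) (ω : ℕ → V) (n : ℕ) : unvisited A ω n ⊆ A := by
  classical
  exact Finset.filter_subset _ _

open Classical in
/-- The indicator that `A` is not covered by time `n`. -/
def alive (A : Finset V) (n : ℕ) (ω : ℕ → V) : ℝ≥0∞ :=
  if (unvisited A ω n).Nonempty then 1 else 0

lemma stepsToCover_le_tsum [Fintype V] (ω : ℕ → V) :
    stepsToCover ω ≤ ∑' n, alive Finset.univ n ω := by
  classical
  by_cases h : ∃ n, ¬ (unvisited Finset.univ ω n).Nonempty
  · let T := Nat.find h
    have hT : ∀ v : V, ∃ s ≤ T, ω s = v := by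
      have := Nat.find_spec h
      rw [Finset.not_nonempty_iff_eq_empty] at this
      intro v
      by_contra! hv
      have h2 : v ∈ unvisited Finset.univ ω T := by
        simp only [unvisited, Finset.mem_filter, Finset.mem_univ, true_and]
        exact hv
      rw [this] at h2
      simp at h2
    calc stepsToCover ω ≤ (T : ℝ≥0∞) := iInf₂_le T hT
      _ = ∑ n ∈ Finset.range T, alive Finset.univ n ω := by
          rw [Finset.sum_congr rfl (g := fun _ => 1)]
          · simp
          · intro n hn
            have := Nat.find_min h (Finset.mem_range.1 hn)
            rw [not_not] at this
            simp [alive, this]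
      _ ≤ _ := ENNReal.sum_le_tsum _
  · push Not at h
    have : ∑' n, alive Finset.univ n ω = ∑' _ : ℕ, (1 : ℝ≥0∞) := by
      congr 1; ext n; simp [alive, h n]
    rw [this, ENNReal.tsum_const_eq_top_of_ne_zero one_ne_zero]
    exact le_top

lemma tsum_le_stepsToCover (A : Finset V) (ω : ℕ → V) :
    ∑' n, alive A n ω ≤ stepsToCover ω := by
  refine le_iInf₂ fun t ht => ?_
  have h0 : ∀ n, t ≤ n → alive A n ω = 0 := by
    intro n hn
    rw [alive, if_neg]
    rintro ⟨v, hv⟩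
    obtain ⟨s, hs, rfl⟩ := ht v
    simp only [unvisited, Finset.mem_filter] at hv
    exact hv.2 s (hs.trans hn) rfl
  rw [tsum_eq_sum (s := Finset.range t) (fun n hn => h0 n (by simpa using hn))]
  calc _ ≤ ∑ n ∈ Finset.range t, (1 : ℝ≥0∞) :=
        Finset.sum_le_sum fun n _ => by unfold alive; split_ifs <;> simp
    _ = t := by simp

end Trajectory

/-! ### Markov property and drift criteria for the cover time -/

variable {V : Type*} [MeasurableSpace V] [DiscreteMeasurableSpace V] [Finite V]

/-- The Markov property of the random walk, for functions of the history and the next position. -/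
lemma lintegral_law_succ (G : SimpleGraph V) (u : V) (n : ℕ)
    (F : ((_ : Finset.Iic n) → V) → V → ℝ≥0∞) :
    ∫⁻ ω, F (Preorder.frestrictLe n ω) (ω (n + 1)) ∂(law G u) =
      ∫⁻ ω, ∫⁻ y, F (Preorder.frestrictLe n ω) y ∂(step G (ω n)) ∂(law G u) := by
  have hF : Measurable (Function.uncurry F) := measurable_of_countable _
  have key := Kernel.partialTraj_compProd_eq_map_traj (κ := historyStep G) (Nat.zero_le n)
    (X := fun _ => V) (x₀ := fun _ => u)
  have h1 : ∫⁻ ω, F (Preorder.frestrictLe n ω) (ω (n + 1)) ∂(law G u) =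
      ∫⁻ p, Function.uncurry F p ∂((law G u).map
        (fun x => (Preorder.frestrictLe n x, x (n + 1)))) := by
    rw [lintegral_map hF (by fun_prop)]
    rfl
  rw [h1, law, ← key, Measure.lintegral_compProd hF, ← Kernel.traj_map_frestrictLe_apply,
    lintegral_map (measurable_of_countable _) (by fun_prop)]
  rfl

lemma law_ae_zero (G : SimpleGraph V) (u : V) : ∀ᵐ ω ∂(law G u), ω 0 = u := by
  have h := Kernel.traj_map_frestrictLe_apply (X := fun _ => V) (κ := historyStep G) 0 0
    (fun _ => u)
  rw [Kernel.partialTraj_self, Kernel.id_apply] at h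
  have h2 : ∀ᵐ x ∂((law G u).map (Preorder.frestrictLe 0)), x ⟨0, by simp⟩ = u := by
    rw [law, h, ae_dirac_iff (DiscreteMeasurableSpace.forall_measurableSet _)]
  exact ae_of_ae_map (by fun_prop) h2

instance (G : SimpleGraph V) (u : V) : IsProbabilityMeasure (law G u) := by
  unfold law; infer_instance

/-- Only the first `n + 1` positions matter, and they range over a finite discrete space. -/
lemma measurable_unvisited {β : Type*} [MeasurableSpace β] (A : Finset V) (n : ℕ)
    (f : V → Finset V → β) : Measurable (fun ω : ℕ → V => f (ω n) (unvisited A ω n)) := by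
  have : (fun ω : ℕ → V => f (ω n) (unvisited A ω n)) =
      (fun x : (_ : Finset.Iic n) → V => f (x ⟨n, by simp⟩) (missing A n x)) ∘
        Preorder.frestrictLe n := by
    ext ω
    simp only [Function.comp_apply, missing_frestrictLe]
    rfl
  rw [this]
  exact (measurable_of_countable _).comp (by fun_prop)

open Classical in
lemma measurable_alive (A : Finset V) (n : ℕ) : Measurable (alive A n) :=
  measurable_unvisited A n (fun _ S => if S.Nonempty then (1 : ℝ≥0∞) else 0)

lemma lintegral_tsum_alive (G : SimpleGraph V) (u : V) (A : Finset V) :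
    ∫⁻ ω, ∑' n, alive A n ω ∂(law G u) = ∑' n, ∫⁻ ω, alive A n ω ∂(law G u) :=
  lintegral_tsum fun n => (measurable_alive A n).aemeasurable

/-- The expected value of a function of the current position and of the unvisited part of `A`. -/
def expectation (G : SimpleGraph V) (u : V) (A : Finset V) (ψ : V → Finset V → ℝ≥0∞) (n : ℕ) :
    ℝ≥0∞ :=
  ∫⁻ ω, ψ (ω n) (unvisited A ω n) ∂(law G u)

open Classical in
lemma expectation_zero (G : SimpleGraph V) (u : V) (A : Finset V) (ψ : V → Finset V → ℝ≥0∞) :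
    expectation G u A ψ 0 = ψ u (A.erase u) := by
  unfold expectation
  rw [lintegral_congr_ae (g := fun _ => ψ u (A.erase u))]
  · simp
  · filter_upwards [law_ae_zero G u] with ω h
    simp [unvisited_zero, h]

open Classical in
lemma expectation_succ (G : SimpleGraph V) (u : V) (A : Finset V) (ψ : V → Finset V → ℝ≥0∞)
    (n : ℕ) :
    expectation G u A ψ (n + 1) =
      ∫⁻ ω, ∫⁻ y, ψ y ((unvisited A ω n).erase y) ∂(step G (ω n)) ∂(law G u) := by
  have := lintegral_law_succ G u n (fun x y => ψ y ((missing A n x).erase y))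
  simp only [missing_frestrictLe] at this
  rw [← this]
  simp only [expectation, unvisited_succ]

open Classical in
/-- A function that decreases on average by one at each step until the walk has covered the graph
bounds the cover time from above. -/
lemma coverTimeFrom_le [Fintype V] (G : SimpleGraph V) (u : V) (ψ : V → Finset V → ℝ≥0∞)
    (h : ∀ x S, S.Nonempty → x ∉ S → 1 + ∫⁻ y, ψ y (S.erase y) ∂(step G x) ≤ ψ x S)
    (h0 : ∀ x, ψ x ∅ = 0) :
    coverTimeFrom G u ≤ ψ u (Finset.univ.erase u) := by
  have hstep : ∀ n, ∫⁻ ω, alive Finset.univ n ω ∂(law G u) +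
      expectation G u Finset.univ ψ (n + 1) ≤ expectation G u Finset.univ ψ n := by
    intro n
    rw [expectation_succ, ← lintegral_add_left (measurable_alive _ _)]
    refine lintegral_mono fun ω => ?_
    by_cases hS : (unvisited Finset.univ ω n).Nonempty
    · simpa [alive, hS] using h (ω n) _ hS (notMem_unvisited _ _ _)
    · have hS' := Finset.not_nonempty_iff_eq_empty.1 hS
      simp [alive, hS', h0]
  have hsum : ∀ n, ∑ k ∈ Finset.range n, ∫⁻ ω, alive Finset.univ k ω ∂(law G u) +
      expectation G u Finset.univ ψ n ≤ expectation G u Finset.univ ψ 0 := by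
    intro n
    induction n with
    | zero => simp
    | succ n ih =>
      rw [Finset.sum_range_succ, add_assoc]
      exact (add_le_add_right (hstep n) _).trans ih
  calc coverTimeFrom G u ≤ ∫⁻ ω, ∑' n, alive Finset.univ n ω ∂(law G u) :=
        lintegral_mono fun ω => stepsToCover_le_tsum ω
    _ = ∑' n, ∫⁻ ω, alive Finset.univ n ω ∂(law G u) := lintegral_tsum_alive G u _
    _ ≤ ψ u (Finset.univ.erase u) := by
        rw [← expectation_zero G u Finset.univ ψ]
        refine ENNReal.tsum_le_of_sum_range_le fun n => ?_
        exact le_self_add.trans (hsum n)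

open Classical in
/-- A bounded function that decreases on average by at most one at each step until the walk has
covered `A` bounds the cover time from below. -/
lemma le_coverTimeFrom (G : SimpleGraph V) (u : V) (A : Finset V) (ψ : V → Finset V → ℝ≥0∞)
    (h : ∀ x S, S ⊆ A → S.Nonempty → x ∉ S → ψ x S ≤ 1 + ∫⁻ y, ψ y (S.erase y) ∂(step G x))
    (h0 : ∀ x, ψ x ∅ = 0) (B : ℝ≥0∞) (hB : B ≠ ∞) (hψ : ∀ x S, ψ x S ≤ B) :
    ψ u (A.erase u) ≤ coverTimeFrom G u := by
  set p : ℕ → ℝ≥0∞ := fun n => ∫⁻ ω, alive A n ω ∂(law G u) with hp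
  have hstep : ∀ n, expectation G u A ψ n ≤ p n + expectation G u A ψ (n + 1) := by
    intro n
    rw [expectation_succ, hp, ← lintegral_add_left (measurable_alive _ _)]
    refine lintegral_mono fun ω => ?_
    by_cases hS : (unvisited A ω n).Nonempty
    · simpa [alive, hS] using h (ω n) _ (unvisited_subset A ω n) hS (notMem_unvisited _ _ _)
    · have hS' := Finset.not_nonempty_iff_eq_empty.1 hS
      simp [alive, hS', h0]
  have hsum : ∀ n, expectation G u A ψ 0 ≤
      ∑ k ∈ Finset.range n, p k + expectation G u A ψ n := by
    intro n
    induction n with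
    | zero => simp
    | succ n ih =>
      rw [Finset.sum_range_succ, add_assoc]
      exact ih.trans (add_le_add_right (hstep n) _)
  -- The potential vanishes once `A` is covered, so its mean is at most its bound times the survival
  -- probability. This tends to zero when the survival probabilities are summable; otherwise the
  -- cover time is infinite.
  have hbound : ∀ n, expectation G u A ψ n ≤ B * p n := by
    intro n
    rw [hp, ← lintegral_const_mul _ (measurable_alive _ _)]
    refine lintegral_mono fun ω => ?_
    by_cases hS : (unvisited A ω n).Nonempty
    · simpa [alive, hS] using hψ (ω n) _
    · have hS' := Finset.not_nonempty_iff_eq_empty.1 hS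
      simp [hS', h0]
  have hle : ∑' n, p n ≤ coverTimeFrom G u := by
    rw [hp, ← lintegral_tsum_alive]
    exact lintegral_mono fun ω => tsum_le_stepsToCover A ω
  refine le_trans ?_ hle
  by_cases htop : ∑' n, p n = ∞
  · rw [htop]; exact le_top
  have hlim : Filter.Tendsto (fun n => ∑' k, p k + B * p n) Filter.atTop
      (nhds (∑' k, p k + B * 0)) :=
    tendsto_const_nhds.add (ENNReal.Tendsto.const_mul
      (ENNReal.tendsto_atTop_zero_of_tsum_ne_top htop) (Or.inr hB))
  rw [mul_zero, add_zero] at hlim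
  rw [← expectation_zero G u A ψ]
  exact ge_of_tendsto' hlim fun n =>
    (hsum n).trans (add_le_add (ENNReal.sum_le_tsum _) (hbound n))

end RandomWalk

/-! ### Neighbour sums and one step of the walk -/

namespace RandomWalk

section NeighborSum

variable {V : Type*}

/-- The sum of `f` over the neighbours of `x`. -/
def nbrSum (G : SimpleGraph V) (x : V) (f : V → ℝ) : ℝ :=
  ∑ᶠ y ∈ G.neighborSet x, f y

open Classical in
lemma nbrSum_eq_sum [Fintype V] (G : SimpleGraph V) (x : V) (f : V → ℝ) :
    nbrSum G x f = ∑ y ∈ G.neighborFinset x, f y := by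
  rw [nbrSum, ← finsum_mem_coe_finset, SimpleGraph.coe_neighborFinset]

variable [Finite V]

lemma nbrSum_add (G : SimpleGraph V) (x : V) (f f' : V → ℝ) :
    nbrSum G x (fun y => f y + f' y) = nbrSum G x f + nbrSum G x f' := by
  have := Fintype.ofFinite V
  simp [nbrSum_eq_sum, Finset.sum_add_distrib]

lemma nbrSum_const_mul (G : SimpleGraph V) (x : V) (c : ℝ) (f : V → ℝ) :
    nbrSum G x (fun y => c * f y) = c * nbrSum G x f := by
  have := Fintype.ofFinite V
  simp [nbrSum_eq_sum, Finset.mul_sum]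

lemma nbrSum_sum {ι : Type*} (s : Finset ι) (G : SimpleGraph V) (x : V) (f : ι → V → ℝ) :
    nbrSum G x (fun y => ∑ i ∈ s, f i y) = ∑ i ∈ s, nbrSum G x (f i) := by
  have := Fintype.ofFinite V
  simp only [nbrSum_eq_sum]
  exact Finset.sum_comm

lemma nbrSum_mono (G : SimpleGraph V) (x : V) {f f' : V → ℝ}
    (h : ∀ y, G.Adj x y → f y ≤ f' y) : nbrSum G x f ≤ nbrSum G x f' := by
  have := Fintype.ofFinite V
  classical
  simp only [nbrSum_eq_sum]
  exact Finset.sum_le_sum fun y hy => h y (by simpa using hy)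

lemma le_nbrSum (G : SimpleGraph V) {x y : V} {f : V → ℝ} (hf : ∀ z, 0 ≤ f z)
    (h : G.Adj x y) : f y ≤ nbrSum G x f := by
  have := Fintype.ofFinite V
  classical
  rw [nbrSum_eq_sum]
  exact Finset.single_le_sum (fun z _ => hf z) (by simpa using h)

lemma nbrSum_shift (G : SimpleGraph V) (x : V) (f : V → ℝ) (c : ℝ) :
    nbrSum G x (fun y => f y + 1 - c) = nbrSum G x f + nbrSum G x (fun _ => 1) * (1 - c) := by
  rw [mul_comm, ← nbrSum_const_mul, ← nbrSum_add]
  congr 1; ext y; ring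

lemma nbrSum_one_pos (G : SimpleGraph V) (x : V) (hx : (G.neighborSet x).Nonempty) :
    0 < nbrSum G x (fun _ => 1) := by
  obtain ⟨y, hy⟩ := hx
  exact zero_lt_one.trans_le (le_nbrSum G (f := fun _ => 1) (fun _ => zero_le_one) hy)

end NeighborSum

section Step

variable {V : Type*} [MeasurableSpace V] [DiscreteMeasurableSpace V] [Finite V]

lemma one_add_lintegral_step (G : SimpleGraph V) (x : V) (hx : (G.neighborSet x).Nonempty)
    (f : V → ℝ) (hf : ∀ y, 0 ≤ f y) :
    1 + ∫⁻ y, ENNReal.ofReal (f y) ∂(step G x) =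
      ENNReal.ofReal (1 + nbrSum G x f / nbrSum G x (fun _ => 1)) := by
  have := Fintype.ofFinite V
  classical
  have h0 : 0 ≤ nbrSum G x f := by
    rw [nbrSum_eq_sum]; exact Finset.sum_nonneg fun y _ => hf y
  have hcard : 0 < (G.neighborFinset x).card := by
    rw [Finset.card_pos]
    obtain ⟨y, hy⟩ := hx
    exact ⟨y, by simpa using hy⟩
  have hd : nbrSum G x (fun _ => 1) = ((G.neighborFinset x).card : ℝ) := by
    simp [nbrSum_eq_sum]
  have hs : step G x = uniformOn (G.neighborFinset x : Set V) := by
    rw [SimpleGraph.coe_neighborFinset]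
    change (if (G.neighborSet x).Nonempty then uniformOn (G.neighborSet x)
      else Measure.dirac x) = _
    rw [if_pos hx]
  rw [hd, hs, nbrSum_eq_sum]
  rw [nbrSum_eq_sum] at h0
  generalize G.neighborFinset x = s at *
  rw [ENNReal.ofReal_add zero_le_one (div_nonneg h0 (Nat.cast_nonneg _)), ENNReal.ofReal_one]
  congr 1
  rw [uniformOn, ProbabilityTheory.cond, lintegral_smul_measure, lintegral_finset,
    Measure.count_apply_finset, ENNReal.ofReal_div_of_pos (by positivity),
    ENNReal.ofReal_sum_of_nonneg (fun y _ => hf y), ENNReal.ofReal_natCast,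
    ENNReal.div_eq_inv_mul]
  simp

/-- Multiplying the drift inequality by the degree makes it linear in neighbour sums, so that later
checks involve no division by degrees. -/
lemma one_add_lintegral_step_le (G : SimpleGraph V) (x : V) (hx : (G.neighborSet x).Nonempty)
    (f : V → ℝ) (hf : ∀ y, 0 ≤ f y) (c : ℝ) (h : nbrSum G x (fun y => f y + 1 - c) ≤ 0) :
    1 + ∫⁻ y, ENNReal.ofReal (f y) ∂(step G x) ≤ ENNReal.ofReal c := by
  rw [one_add_lintegral_step G x hx f hf]
  have hd := nbrSum_one_pos G x hx
  rw [nbrSum_shift] at h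
  refine ENNReal.ofReal_le_ofReal ?_
  rw [← le_sub_iff_add_le', div_le_iff₀ hd]
  linarith

lemma le_one_add_lintegral_step (G : SimpleGraph V) (x : V) (hx : (G.neighborSet x).Nonempty)
    (f : V → ℝ) (hf : ∀ y, 0 ≤ f y) (c : ℝ) (h : 0 ≤ nbrSum G x (fun y => f y + 1 - c)) :
    ENNReal.ofReal c ≤ 1 + ∫⁻ y, ENNReal.ofReal (f y) ∂(step G x) := by
  rw [one_add_lintegral_step G x hx f hf]
  have hd := nbrSum_one_pos G x hx
  rw [nbrSum_shift] at h
  refine ENNReal.ofReal_le_ofReal ?_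
  rw [← sub_le_iff_le_add', le_div_iff₀ hd]
  linarith

end Step

/-! ### Matthews' bounds -/

section Matthews

variable {V : Type*}

/-- `h y v` is the expected hitting time of `v` from `y` in the graph `G` with `E` edges, as
characterised by the first-step equation (off `v`) and the return time identity (at `v`). -/
structure IsHittingTime (G : SimpleGraph V) (E : ℝ) (h : V → V → ℝ) : Prop where
  self : ∀ v, h v v = 0
  nonneg : ∀ x v, 0 ≤ h x v
  nbrSum_self : ∀ v, nbrSum G v (fun y => h y v + 1 - h v v) = 2 * E
  nbrSum_of_ne : ∀ x v, x ≠ v → nbrSum G x (fun y => h y v + 1 - h x v) = 0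

lemma IsHittingTime.neighborSet_nonempty {G : SimpleGraph V} {E : ℝ} {h : V → V → ℝ}
    (hh : IsHittingTime G E h) (hE : 0 < E) (x : V) : (G.neighborSet x).Nonempty := by
  by_contra hne
  have := hh.nbrSum_self x
  rw [nbrSum, Set.not_nonempty_iff_eq_empty.1 hne, finsum_mem_empty] at this
  linarith

open Classical in
/-- The potential behind Matthews' bounds: the mean time to hit a uniformly chosen point of `S`,
followed by the harmonic estimate for what is then left of `S`. -/
def matthews (h : V → V → ℝ) (m : ℝ) (x : V) (S : Finset V) : ℝ :=
  if S.Nonempty then (∑ s ∈ S, h x s) / S.card + m * ((harmonic S.card : ℝ) - 1) else 0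

lemma matthews_empty (h : V → V → ℝ) (m : ℝ) (x : V) : matthews h m x ∅ = 0 := by
  simp [matthews]

lemma one_le_harmonic {n : ℕ} (hn : n ≠ 0) : (1 : ℝ) ≤ harmonic n := by
  obtain ⟨k, rfl⟩ := Nat.exists_eq_succ_of_ne_zero hn
  have h : (1 : ℚ) ≤ harmonic (k + 1) := by
    rw [harmonic, Finset.sum_range_succ']
    have : (0 : ℚ) ≤ ∑ i ∈ Finset.range k, (((i + 1 : ℕ) : ℚ) + 1)⁻¹ :=
      Finset.sum_nonneg fun i _ => by positivity
    push_cast at this ⊢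
    norm_num
    linarith
  exact_mod_cast h

lemma matthews_nonneg {h : V → V → ℝ} (hh : ∀ x v, 0 ≤ h x v) {m : ℝ} (hm : 0 ≤ m) (x : V)
    (S : Finset V) : 0 ≤ matthews h m x S := by
  unfold matthews
  split_ifs with hS
  · have := one_le_harmonic (Finset.card_pos.2 hS).ne'
    have h2 : 0 ≤ ∑ s ∈ S, h x s := Finset.sum_nonneg fun s _ => hh x s
    have : 0 ≤ m * ((harmonic S.card : ℝ) - 1) := mul_nonneg hm (by linarith)
    positivity
  · exact le_rfl

open Classical in
/-- The change of the potential when a point `y` of `S` is visited. -/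
lemma matthews_erase {h : V → V → ℝ} (hself : ∀ v, h v v = 0) (m : ℝ) (y : V) (S : Finset V)
    (hy : y ∈ S) :
    ∃ w : ℝ, 0 ≤ w ∧ matthews h m y (S.erase y) = matthews h m y S +
      w * (∑ s ∈ S.erase y, (h y s - m)) := by
  have hsum : ∑ s ∈ S, h y s = ∑ s ∈ S.erase y, h y s := by
    rw [← Finset.add_sum_erase _ _ hy, hself, zero_add]
  have hS : S.Nonempty := ⟨y, hy⟩
  by_cases he : (S.erase y).Nonempty
  · have hc : S.card = (S.erase y).card + 1 := (Finset.card_erase_add_one hy).symm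
    have hk : (0 : ℝ) < (S.erase y).card := by exact_mod_cast Finset.card_pos.2 he
    -- With `k` points left, the mean gains its sum times `1/k - 1/(k+1)` and the harmonic term
    -- loses `m/(k+1)`; the common factor is `1/(k(k+1))`. The sign of the change is thus governed
    -- by comparing hitting times with `m`.
    refine ⟨1 / ((S.erase y).card * ((S.erase y).card + 1)), by positivity, ?_⟩
    rw [matthews, if_pos he, matthews, if_pos hS, hsum, hc, harmonic_succ,
      Finset.sum_sub_distrib, Finset.sum_const, nsmul_eq_mul]
    push_cast
    field_simp
    ring
  · refine ⟨0, le_rfl, ?_⟩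
    have hc : S.card = 1 := by
      rw [← Finset.card_erase_add_one hy, Finset.not_nonempty_iff_eq_empty.1 he]; rfl
    rw [matthews, if_neg he, matthews, if_pos hS, hsum, hc,
      Finset.not_nonempty_iff_eq_empty.1 he]
    simp

variable [Finite V]

/-- With `S` held fixed, the potential is an average of hitting times plus a constant, and each
first-step equation holds at `x` because `x` is not its target. -/
lemma nbrSum_matthews {G : SimpleGraph V} {E : ℝ} {h : V → V → ℝ} (hh : IsHittingTime G E h)
    (m : ℝ) (x : V) (S : Finset V) (hS : S.Nonempty) (hx : x ∉ S) :
    nbrSum G x (fun y => matthews h m y S + 1 - matthews h m x S) = 0 := by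
  have hk : (0 : ℝ) < S.card := by exact_mod_cast Finset.card_pos.2 hS
  have : (fun y => matthews h m y S + 1 - matthews h m x S) =
      fun y => (1 / (S.card : ℝ)) * ∑ s ∈ S, (h y s + 1 - h x s) := by
    ext y
    simp only [matthews, if_pos hS, Finset.sum_sub_distrib, Finset.sum_add_distrib,
      Finset.sum_const, nsmul_eq_mul]
    field_simp
    ring
  rw [this, nbrSum_const_mul, nbrSum_sum, Finset.sum_eq_zero, mul_zero]
  intro s hs
  exact hh.nbrSum_of_ne x s (by rintro rfl; exact hx hs)

variable [MeasurableSpace V] [DiscreteMeasurableSpace V]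

open Classical in
/-- Matthews' upper bound for the cover time. -/
theorem coverTime_le_of_hittingTime_le [Fintype V] {G : SimpleGraph V} {E : ℝ} {h : V → V → ℝ}
    (hh : IsHittingTime G E h) (hE : 0 < E) {M : ℝ} (hM0 : 0 ≤ M) (hM : ∀ x v, h x v ≤ M) :
    coverTime G ≤ ENNReal.ofReal (M * harmonic (Fintype.card V)) := by
  refine iSup_le fun u => ?_
  refine (coverTimeFrom_le G u (fun x S => ENNReal.ofReal (matthews h M x S)) ?_ ?_).trans ?_
  · intro x S hS hx
    refine one_add_lintegral_step_le G x (hh.neighborSet_nonempty hE x) _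
      (fun y => matthews_nonneg hh.nonneg hM0 _ _) _ ?_
    rw [← nbrSum_matthews hh M x S hS hx]
    refine nbrSum_mono G x fun y _ => ?_
    by_cases hy : y ∈ S
    · obtain ⟨w, hw, he⟩ := matthews_erase hh.self M y S hy
      have : ∑ s ∈ S.erase y, (h y s - M) ≤ 0 :=
        Finset.sum_nonpos fun s _ => sub_nonpos.2 (hM y s)
      have := mul_nonpos_of_nonneg_of_nonpos hw this
      linarith
    · rw [Finset.erase_eq_of_notMem hy]
  · intro x
    simp [matthews_empty]
  · refine ENNReal.ofReal_le_ofReal ?_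
    have hmono : (harmonic (Finset.univ.erase u).card : ℝ) ≤ harmonic (Fintype.card V) := by
      have : harmonic (Finset.univ.erase u).card ≤ harmonic (Fintype.card V) := by
        unfold harmonic
        refine Finset.sum_le_sum_of_subset_of_nonneg ?_ fun i _ _ => by positivity
        exact Finset.range_mono (Finset.card_le_univ _)
      exact_mod_cast this
    refine le_trans ?_ (mul_le_mul_of_nonneg_left hmono hM0)
    unfold matthews
    split_ifs with hS
    · have hk : (0 : ℝ) < (Finset.univ.erase u).card := by exact_mod_cast Finset.card_pos.2 hS
      have : (∑ s ∈ Finset.univ.erase u, h u s) / (Finset.univ.erase u).card ≤ M := by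
        rw [div_le_iff₀ hk, mul_comm, ← nsmul_eq_mul]
        exact Finset.sum_le_card_nsmul _ _ _ fun s _ => hM u s
      linarith
    · rw [Finset.not_nonempty_iff_eq_empty.1 hS]
      simp

/-- Matthews' lower bound for the cover time. -/
theorem le_coverTime_of_le_hittingTime {G : SimpleGraph V} {E : ℝ} {h : V → V → ℝ}
    (hh : IsHittingTime G E h) (hE : 0 < E) {m : ℝ} (hm0 : 0 ≤ m) (A : Finset V)
    (hA : 2 ≤ A.card) (hm : ∀ x, ∀ v ∈ A, x ≠ v → m ≤ h x v) :
    ENNReal.ofReal (m * harmonic (A.card - 1)) ≤ coverTime G := by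
  have := Fintype.ofFinite V
  classical
  obtain ⟨u, hu⟩ : A.Nonempty := Finset.card_pos.1 (by omega)
  refine le_trans ?_ (le_iSup _ u)
  obtain ⟨B, hB'⟩ := (Set.finite_range fun p : V × Finset V => matthews h m p.1 p.2).bddAbove
  have hB : ∀ p : V × Finset V, matthews h m p.1 p.2 ≤ B := fun p => hB' ⟨p, rfl⟩
  refine le_trans ?_ (le_coverTimeFrom G u A (fun x S => ENNReal.ofReal (matthews h m x S)) ?_ ?_
    (ENNReal.ofReal B) ENNReal.ofReal_ne_top fun x S => ENNReal.ofReal_le_ofReal (hB (x, S)))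
  · refine ENNReal.ofReal_le_ofReal ?_
    have hc : (A.erase u).card = A.card - 1 := Finset.card_erase_of_mem hu
    have hS : (A.erase u).Nonempty := Finset.card_pos.1 (by omega)
    rw [matthews, if_pos hS, ← hc]
    have hk : (0 : ℝ) < (A.erase u).card := by exact_mod_cast Finset.card_pos.2 hS
    have : m ≤ (∑ s ∈ A.erase u, h u s) / (A.erase u).card := by
      rw [le_div_iff₀ hk, mul_comm, ← nsmul_eq_mul]
      exact Finset.card_nsmul_le_sum _ _ _ fun s hs =>
        hm u s (Finset.mem_of_mem_erase hs) (Finset.ne_of_mem_erase hs).symm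
    linarith
  · intro x S hSA hS hx
    refine le_one_add_lintegral_step G x (hh.neighborSet_nonempty hE x) _
      (fun y => matthews_nonneg hh.nonneg hm0 _ _) _ ?_
    rw [← nbrSum_matthews hh m x S hS hx]
    refine nbrSum_mono G x fun y _ => ?_
    by_cases hy : y ∈ S
    · obtain ⟨w, hw, he⟩ := matthews_erase hh.self m y S hy
      have : 0 ≤ ∑ s ∈ S.erase y, (h y s - m) :=
        Finset.sum_nonneg fun s hs => sub_nonneg.2
          (hm y s (hSA (Finset.mem_of_mem_erase hs)) (Finset.ne_of_mem_erase hs).symm)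
      have := mul_nonneg hw this
      linarith
    · rw [Finset.erase_eq_of_notMem hy]
  · intro x
    simp [matthews_empty]

end Matthews

end RandomWalk

/-! ### Growing a graph: neighbour sums, edge counts and hitting times -/

namespace RandomWalk

section NeighborSum

variable {V : Type*}

lemma nbrSum_ite_eq [Finite V] [DecidableEq V] (G : SimpleGraph V) (x v : V) [Decidable (G.Adj x v)] (c : ℝ) :
    nbrSum G x (fun y => if y = v then c else 0) = if G.Adj x v then c else 0 := by
  have := Fintype.ofFinite V
  simp [nbrSum_eq_sum]

open Classical in
lemma sum_nbrSum_one [Fintype V] (G : SimpleGraph V) :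
    ∑ x, nbrSum G x (fun _ => 1) = 2 * (Nat.card G.edgeSet : ℝ) := by
  simp only [nbrSum_eq_sum, Finset.sum_const, nsmul_eq_mul, mul_one,
    SimpleGraph.card_neighborFinset_eq_degree]
  rw [← Nat.cast_sum, SimpleGraph.sum_degrees_eq_twice_card_edges,
    SimpleGraph.edgeFinset_card, Nat.card_eq_fintype_card]
  push_cast
  rfl

end NeighborSum

end RandomWalk

namespace Pseudofractal

open RandomWalk

variable {V : Type} {G : SimpleGraph V}

/-- The sum of `k` over the two ends of the edge `e`. -/
def endSum (e : Sym2 V) (k : V → ℝ) : ℝ :=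
  Sym2.lift ⟨fun a b => k a + k b, fun _ _ => add_comm _ _⟩ e

@[simp]
lemma endSum_mk (a b : V) (k : V → ℝ) : endSum s(a, b) k = k a + k b := rfl

lemma edge_induction {p : G.edgeSet → Prop} (h : ∀ a b (hab : s(a, b) ∈ G.edgeSet), p ⟨s(a, b), hab⟩)
    (e : G.edgeSet) : p e := by
  obtain ⟨e, he⟩ := e
  induction e using Sym2.ind with
  | _ a b => exact h a b he

lemma nbrSum_grow_inr {a b : V} (hab : s(a, b) ∈ G.edgeSet) (f : V ⊕ G.edgeSet → ℝ) :
    nbrSum (grow G) (Sum.inr ⟨s(a, b), hab⟩) f = f (Sum.inl a) + f (Sum.inl b) := by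
  have : (grow G).neighborSet (Sum.inr ⟨s(a, b), hab⟩) = {Sum.inl a, Sum.inl b} := by
    ext z
    rcases z with x | e
    · change x ∈ s(a, b) ↔ _
      simp
    · change False ↔ _
      simp
  rw [nbrSum, this, finsum_mem_pair]
  simpa using (show G.Adj a b from hab).ne

variable [Finite V]

lemma nbrSum_grow_inl (x : V) (f : V ⊕ G.edgeSet → ℝ) (φ : V → ℝ)
    (hφ : ∀ y (h : s(x, y) ∈ G.edgeSet), f (Sum.inr ⟨s(x, y), h⟩) = φ y) :
    nbrSum (grow G) (Sum.inl x) f = nbrSum G x (fun y => f (Sum.inl y) + φ y) := by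
  have := Fintype.ofFinite V
  classical
  have hset : (grow G).neighborSet (Sum.inl x) =
      Sum.inl '' (G.neighborSet x) ∪ Sum.inr '' {e : G.edgeSet | x ∈ (e : Sym2 V)} := by
    ext z
    rcases z with y | e
    · change G.Adj x y ↔ _
      simp
    · change x ∈ (e : Sym2 V) ↔ _
      simp
  rw [nbrSum_add, nbrSum, hset, finsum_mem_union _ (Set.toFinite _) (Set.toFinite _),
    finsum_mem_image Sum.inl_injective.injOn, finsum_mem_image Sum.inr_injective.injOn]
  · congr 1
    rw [nbrSum_eq_sum, finsum_mem_eq_toFinset_sum]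
    symm
    refine Finset.sum_bij (fun y hy => ⟨s(x, y), by simpa using hy⟩) ?_ ?_ ?_ ?_
    · intro y hy
      simp
    · intro y hy y' hy' h
      exact Sym2.congr_right.1 (congrArg Subtype.val h)
    · intro e
      induction e using edge_induction with | h a b hab => ?_
      intro he
      simp only [Set.mem_toFinset, Set.mem_ofPred_eq, Sym2.mem_iff] at he
      rcases he with rfl | rfl
      · exact ⟨b, by simpa using hab, rfl⟩
      · exact ⟨a, by simpa using G.adj_symm hab, Subtype.ext Sym2.eq_swap⟩
    · intro y hy
      exact (hφ y _).symm
  · rw [Set.disjoint_left]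
    rintro _ ⟨a, _, rfl⟩ ⟨b, _, h⟩
    cases h

/-- Handshake count: old degrees double and each new vertex has degree two. -/
lemma card_edgeSet_grow : Nat.card (grow G).edgeSet = 3 * Nat.card G.edgeSet := by
  have := Fintype.ofFinite V
  have := Fintype.ofFinite G.edgeSet
  have h := sum_nbrSum_one (grow G)
  rw [Fintype.sum_sum_type] at h
  have h1 : ∀ x, nbrSum (grow G) (Sum.inl x) (fun _ => 1) = 2 * nbrSum G x (fun _ => 1) := by
    intro x
    rw [nbrSum_grow_inl x _ (fun _ => 1) (fun _ _ => rfl), nbrSum_add, two_mul]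
  have h2 : ∀ e, nbrSum (grow G) (Sum.inr e) (fun _ => 1) = 2 := by
    refine edge_induction fun a b hab => ?_
    rw [nbrSum_grow_inr]
    norm_num
  simp only [h1, h2, ← Finset.mul_sum, sum_nbrSum_one, Finset.sum_const, nsmul_eq_mul] at h
  rw [Finset.card_univ, ← Nat.card_eq_fintype_card] at h
  have h3 : (Nat.card (grow G).edgeSet : ℝ) = (3 * Nat.card G.edgeSet : ℕ) := by
    push_cast
    linarith
  exact_mod_cast h3

/-- Hitting times in `grow G` of a vertex `v` of `G`, in terms of hitting times in `G`. -/
def growOld (h : V → V → ℝ) (v : V) : V ⊕ G.edgeSet → ℝ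
  | .inl x => 2 * h x v
  | .inr e => 1 + endSum e (fun a => h a v)

open Classical in
/-- Hitting times in `grow G`, in terms of hitting times in `G`, which has `E` edges. -/
def growTime (E : ℝ) (h : V → V → ℝ) (z : V ⊕ G.edgeSet) : V ⊕ G.edgeSet → ℝ
  | .inl v => growOld h v z
  | .inr e => endSum e (fun a => growOld h a z) / 2 +
      (3 * E - endSum e (fun a => growOld h a (Sum.inr e)) / 2) -
      if z = Sum.inr e then 3 * E else 0

open Classical in
lemma nbrSum_hittingTime {W : Type*} {H : SimpleGraph W} {E : ℝ} {h : W → W → ℝ}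
    (hh : IsHittingTime H E h) (x v : W) :
    nbrSum H x (fun y => h y v + 1 - h x v) = if x = v then 2 * E else 0 := by
  split_ifs with hx
  · rw [hx, hh.nbrSum_self]
  · exact hh.nbrSum_of_ne x v hx

variable {E : ℝ} {h : V → V → ℝ}

omit [Finite V] in
lemma growOld_nonneg (hh : IsHittingTime G E h) (v : V) (z : V ⊕ G.edgeSet) :
    0 ≤ growOld h v z := by
  rcases z with x | e
  · exact mul_nonneg zero_le_two (hh.nonneg x v)
  · induction e using edge_induction with
    | h a b hab =>
      have h1 := hh.nonneg a v
      have h2 := hh.nonneg b v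
      simp only [growOld, endSum_mk]
      linarith

open Classical in
-- At an old vertex `x`, each old neighbour `y` is paired with the new vertex on the edge `xy`;
-- together they contribute three times the term of `y` in `G`. At a new vertex the equation is the
-- definition of `growOld`.
lemma nbrSum_growOld (hh : IsHittingTime G E h) (z : V ⊕ G.edgeSet) (v : V) :
    nbrSum (grow G) z (fun y => growOld h v y + 1 - growOld h v z) =
      if z = Sum.inl v then 6 * E else 0 := by
  rcases z with x | e
  · rw [nbrSum_grow_inl x _ (fun y => 1 + (h x v + h y v) + 1 - 2 * h x v) fun y hy => rfl]
    have : (fun y => growOld (G := G) h v (Sum.inl y) + 1 - growOld (G := G) h v (Sum.inl x) +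
        (1 + (h x v + h y v) + 1 - 2 * h x v)) = fun y => 3 * (h y v + 1 - h x v) := by
      ext y
      simp only [growOld]
      ring
    rw [this, nbrSum_const_mul, nbrSum_hittingTime hh]
    simp only [Sum.inl.injEq]
    split_ifs <;> ring
  · induction e using edge_induction with
    | h a b hab =>
      rw [nbrSum_grow_inr, if_neg (by simp)]
      simp only [growOld, endSum_mk]
      ring

/-- This is one term of the return time identity at `a`, whose terms are all nonnegative. -/
lemma hittingTime_add_one_le (hh : IsHittingTime G E h) {a b : V} (hab : G.Adj a b) :
    h b a + 1 ≤ 2 * E := by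
  rw [← hh.nbrSum_self a, hh.self a]
  have := le_nbrSum G (f := fun y => h y a + 1 - 0)
    (fun z => by have := hh.nonneg z a; linarith) hab
  simpa using this

/-- The value at `e` of the averaged `growOld` is at most `2 * E`, by the edge bound applied in both
directions, which leaves at least `E` of the constant `3 * E`. -/
lemma le_growTime (hh : IsHittingTime G E h) (z : V ⊕ G.edgeSet) (e : G.edgeSet)
    (hz : z ≠ Sum.inr e) : E ≤ growTime E h z (Sum.inr e) := by
  induction e using edge_induction with
  | h a b hab =>
    simp only [growTime, if_neg hz, endSum_mk]
    have h1 := growOld_nonneg hh a z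
    have h2 := growOld_nonneg hh b z
    have h3 := hittingTime_add_one_le hh hab
    have h4 := hittingTime_add_one_le hh (G.adj_symm hab)
    simp only [growOld, endSum_mk, hh.self] at *
    linarith

/-- For a new target `e` on the edge `ab`, the average of the solutions for `a` and `b` has excess
`3 * E` at each of `a` and `b` and none elsewhere. Lowering its value at `e` by `3 * E` cancels both
excesses and creates `6 * E` at `e`, as the return identity demands. The additive constant makes the
value at `e` zero. -/
lemma isHittingTime_growTime (hh : IsHittingTime G E h) (hE : 0 ≤ E) :
    IsHittingTime (grow G) (3 * E) (growTime E h) := by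
  classical
  have hself : ∀ v, growTime (G := G) E h v v = 0 := by
    rintro (v | e)
    · simp [growTime, growOld, hh.self]
    · simp only [growTime, if_true]
      ring
  have key : ∀ x v, nbrSum (grow G) x (fun y => growTime E h y v + 1 - growTime E h x v) =
      if x = v then 2 * (3 * E) else 0 := by
    rintro z (v | e)
    · simp only [growTime]
      rw [nbrSum_growOld hh]
      split_ifs <;> ring
    · induction e using edge_induction with
      | h a b hab =>
        have : (fun y => growTime E h y (Sum.inr ⟨s(a, b), hab⟩) + 1 -
            growTime E h z (Sum.inr ⟨s(a, b), hab⟩)) = fun y =>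
            (1 / 2 * (growOld h a y + 1 - growOld h a z) +
              1 / 2 * (growOld h b y + 1 - growOld h b z)) +
            ((if y = Sum.inr ⟨s(a, b), hab⟩ then -(3 * E) else 0) +
              (if z = Sum.inr ⟨s(a, b), hab⟩ then 3 * E else 0) * 1) := by
          ext y
          simp only [growTime, endSum_mk]
          split_ifs <;> ring
        rw [this, nbrSum_add, nbrSum_add, nbrSum_add, nbrSum_const_mul, nbrSum_const_mul,
          nbrSum_const_mul, nbrSum_growOld hh, nbrSum_growOld hh, nbrSum_ite_eq]
        rcases z with x | e
        · have hadj : (grow G).Adj (Sum.inl x) (Sum.inr ⟨s(a, b), hab⟩) ↔ x = a ∨ x = b := by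
            change x ∈ s(a, b) ↔ _
            simp
          have hne := (show G.Adj a b from hab).ne
          simp only [hadj, Sum.inl.injEq, reduceCtorEq, if_false]
          by_cases hxa : x = a
          · have hxb : x ≠ b := by rw [hxa]; exact hne
            simp only [hxa, hne, if_true, if_false, true_or]
            ring
          · by_cases hxb : x = b
            · simp only [hxb, hne.symm, if_true, if_false, or_true]
              ring
            · simp [hxa, hxb]
        · have hadj : ¬ (grow G).Adj (Sum.inr e) (Sum.inr ⟨s(a, b), hab⟩) := id
          simp only [hadj, reduceCtorEq, if_false]
          by_cases he : e = ⟨s(a, b), hab⟩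
          · subst he
            rw [nbrSum_grow_inr]
            simp only [if_true]
            ring
          · simp [he]
  refine ⟨hself, ?_, fun v => ?_, fun x v hx => ?_⟩
  · rintro z (v | e)
    · exact growOld_nonneg hh v z
    · by_cases hz : z = Sum.inr e
      · rw [hz, hself]
      · exact hE.trans (le_growTime hh z e hz)
  · rw [key, if_pos rfl]
  · rw [key, if_neg hx]

omit [Finite V] in
lemma growTime_le (hh : IsHittingTime G E h) (hE : 0 ≤ E) {M : ℝ} (hM : ∀ x v, h x v ≤ M)
    (z w : V ⊕ G.edgeSet) : growTime E h z w ≤ 2 * M + 1 + 3 * E := by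
  have hold : ∀ v, growOld h v z ≤ 2 * M + 1 := by
    intro v
    rcases z with x | e
    · have := hM x v
      simp only [growOld]
      linarith
    · induction e using edge_induction with
      | h a b hab =>
        have h1 := hM a v
        have h2 := hM b v
        simp only [growOld, endSum_mk]
        linarith
  rcases w with v | e
  · have := hold v
    simp only [growTime]
    linarith
  · induction e using edge_induction with
    | h a b hab =>
      have h1 := hold a
      have h2 := hold b
      have h3 := growOld_nonneg hh a (Sum.inr ⟨s(a, b), hab⟩)
      have h4 := growOld_nonneg hh b (Sum.inr ⟨s(a, b), hab⟩)
      simp only [growTime, endSum_mk]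
      split_ifs <;> linarith

end Pseudofractal

/-! ### Size and hitting times of the web -/

namespace Pseudofractal

open RandomWalk

lemma card_edgeSet_web (g : ℕ) : Nat.card (web g).edgeSet = 3 ^ (g + 1) := by
  induction g with
  | zero =>
    change Nat.card (⊤ : SimpleGraph (Fin 3)).edgeSet = _
    rw [Nat.card_eq_fintype_card, ← SimpleGraph.edgeFinset_card,
      SimpleGraph.card_edgeFinset_top_eq_card_choose_two]
    rfl
  | succ g ih =>
    have : Finite (iterate g).1 := instFiniteVertex g
    have h : Nat.card (web (g + 1)).edgeSet = 3 * Nat.card (web g).edgeSet :=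
      card_edgeSet_grow (G := (iterate g).2)
    rw [h, ih, pow_succ 3 (g + 1), mul_comm]

lemma two_mul_card_vertex (g : ℕ) : 2 * Nat.card (Vertex g) = 3 * (3 ^ g + 1) := by
  induction g with
  | zero =>
    change 2 * Nat.card (Fin 3) = _
    simp
  | succ g ih =>
    have : Finite (iterate g).1 := instFiniteVertex g
    have h : Nat.card (Vertex (g + 1)) = Nat.card (Vertex g) + Nat.card (web g).edgeSet :=
      Nat.card_sum (α := (iterate g).1) (β := (iterate g).2.edgeSet)
    rw [h, mul_add, ih, card_edgeSet_web]
    ring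

/-- Hitting times in the triangle. -/
def triangleTime (x v : Fin 3) : ℝ := if x = v then 0 else 2

lemma isHittingTime_triangle : IsHittingTime (⊤ : SimpleGraph (Fin 3)) 3 triangleTime := by
  unfold triangleTime
  have key : ∀ x v : Fin 3, nbrSum ⊤ x (fun y => (if y = v then (0 : ℝ) else 2) + 1 -
      (if x = v then 0 else 2)) = if x = v then 2 * 3 else 0 := by
    intro x v
    have : (⊤ : SimpleGraph (Fin 3)).neighborSet x = (Finset.univ.erase x : Finset (Fin 3)) := by
      ext y
      simp [eq_comm]
    rw [nbrSum, this, finsum_mem_coe_finset]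
    have h0 : (Finset.univ.erase (0 : Fin 3)) = {1, 2} := by decide
    have h1 : (Finset.univ.erase (1 : Fin 3)) = {0, 2} := by decide
    have h2 : (Finset.univ.erase (2 : Fin 3)) = {0, 1} := by decide
    fin_cases x <;> fin_cases v <;> simp [h0, h1, h2] <;> norm_num
  refine ⟨by simp, fun x v => by split_ifs <;> norm_num, fun v => ?_, fun x v hx => ?_⟩
  · rw [key, if_pos rfl]
  · rw [key, if_neg hx]

/-- The hitting times of the web are at most of the order of its size, and at least of that order
for as many targets. -/
lemma exists_hittingTime (g : ℕ) : ∃ h : Vertex g → Vertex g → ℝ,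
    IsHittingTime (web g) (3 ^ (g + 1)) h ∧ (∀ x v, h x v ≤ 10 * 3 ^ g) ∧
    ∃ A : Finset (Vertex g), 3 ≤ A.card ∧ 3 ^ g ≤ A.card ∧
      ∀ x, ∀ v ∈ A, x ≠ v → (3 : ℝ) ^ g ≤ h x v := by
  induction g with
  | zero =>
    refine ⟨triangleTime, ?_, fun x v => ?_, (Finset.univ : Finset (Fin 3)), ?_, ?_,
      fun x v _ hx => ?_⟩
    · rw [zero_add, pow_one]
      exact isHittingTime_triangle
    · unfold triangleTime
      split_ifs <;> norm_num
    · exact (Finset.card_fin 3).ge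
    · rw [pow_zero]
      exact (show 1 ≤ 3 by norm_num).trans (Finset.card_fin 3).ge
    · exact (show (3 : ℝ) ^ 0 ≤ 2 by norm_num).trans (if_neg hx).ge
  | succ g ih =>
    -- The old target set is discarded: the new one consists of all vertices just added, one per
    -- edge of the previous web.
    obtain ⟨h, hh, hM, -⟩ := ih
    have : Finite (iterate g).1 := instFiniteVertex g
    have hE : (0 : ℝ) ≤ 3 ^ (g + 1) := by positivity
    have := Fintype.ofFinite (iterate g).2.edgeSet
    have hcard : (Finset.univ.map (Function.Embedding.inr (α := (iterate g).1)
        (β := (iterate g).2.edgeSet))).card = 3 ^ (g + 1) := by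
      rw [Finset.card_map, Finset.card_univ, ← Nat.card_eq_fintype_card]
      exact card_edgeSet_web g
    refine ⟨growTime (G := (iterate g).2) (3 ^ (g + 1)) h, ?_, fun x v => ?_,
      Finset.univ.map Function.Embedding.inr, ?_, ?_, fun x v hv hx => ?_⟩
    · rw [pow_succ' _ (g + 1)]
      exact isHittingTime_growTime hh hE
    · refine (growTime_le hh hE hM x v).trans ?_
      have : (1 : ℝ) ≤ 3 ^ g := one_le_pow₀ (by norm_num)
      -- The constant 10 closes the recursion: `20 * 3 ^ g + 1 + 9 * 3 ^ g` is at most `30 * 3 ^ g`.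
      rw [pow_succ]
      linarith
    · exact (Nat.le_self_pow (Nat.succ_ne_zero g) 3).trans hcard.ge
    · exact hcard.ge
    · obtain ⟨e, -, rfl⟩ := Finset.mem_map.1 hv
      exact le_growTime hh x e hx

end Pseudofractal

end

/-! ### Conclusion -/

theorem mainTheorem2 :
    (∀ g : ℕ, Nat.card (Pseudofractal.Vertex g) = 3 * (3 ^ g + 1) / 2) ∧
    ∃ c₁ c₂ : ℝ, 0 < c₁ ∧ 0 < c₂ ∧ ∀ g : ℕ,
      ENNReal.ofReal (c₁ * ((Nat.card (Pseudofractal.Vertex g) : ℝ) *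
          Real.log (Nat.card (Pseudofractal.Vertex g) : ℝ))) ≤
        RandomWalk.coverTime (Pseudofractal.web g) ∧
      RandomWalk.coverTime (Pseudofractal.web g) ≤
        ENNReal.ofReal (c₂ * ((Nat.card (Pseudofractal.Vertex g) : ℝ) *
          Real.log (Nat.card (Pseudofractal.Vertex g) : ℝ))) := by
  refine ⟨fun g => by have := Pseudofractal.two_mul_card_vertex g; omega,
    1 / 9, 20, by norm_num, by norm_num, fun g => ?_⟩
  obtain ⟨h, hh, hM, A, hA3, hAg, hm⟩ := Pseudofractal.exists_hittingTime g
  have hE : (0 : ℝ) < 3 ^ (g + 1) := by positivity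
  have hN := Pseudofractal.two_mul_card_vertex g
  have := Fintype.ofFinite (Pseudofractal.Vertex g)
  set N := Nat.card (Pseudofractal.Vertex g) with hNdef
  have hp : 1 ≤ 3 ^ g := Nat.one_le_pow _ _ (by norm_num)
  have hN3 : 3 ≤ N := by omega
  have hN3' : (3 : ℝ) ≤ N := by exact_mod_cast hN3
  have hNg : 3 ^ g ≤ N := by omega
  have hNg' : (3 : ℝ) ^ g ≤ N := by exact_mod_cast hNg
  have hNle : N ≤ 3 * 3 ^ g := by omega
  have hNle' : (N : ℝ) ≤ 3 * 3 ^ g := by exact_mod_cast hNle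
  -- This absorbs the 1 in the bound of the harmonic number by `1 + log N`.
  have hlogN : 1 ≤ Real.log N := by
    rw [Real.le_log_iff_exp_le (by linarith)]
    exact (Real.exp_one_lt_d9.le.trans (by norm_num)).trans hN3'
  constructor
  · refine le_trans (ENNReal.ofReal_le_ofReal ?_)
      (RandomWalk.le_coverTime_of_le_hittingTime hh hE (by positivity) A (by omega) hm)
    have hlogA : Real.log A.card ≤ harmonic (A.card - 1) := by
      have := log_add_one_le_harmonic (A.card - 1)
      rwa [Nat.sub_add_cancel (by omega)] at this
    have hA3' : (3 : ℝ) ≤ A.card := by exact_mod_cast hA3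
    have hAg' : (3 : ℝ) ^ g ≤ A.card := by exact_mod_cast hAg
    -- Here `N ≤ 3 * 3 ^ g ≤ A.card ^ 2`; the factor 3 is why `3 ≤ A.card` is kept alongside `3 ^ g
    -- ≤ A.card`.
    have hlog : Real.log N ≤ 2 * Real.log A.card := by
      calc Real.log N ≤ Real.log ((A.card : ℝ) * A.card) := by
            refine Real.log_le_log (by linarith) (hNle'.trans ?_)
            gcongr
        _ = 2 * Real.log A.card := by
            rw [Real.log_mul (by linarith) (by linarith)]; ring
    have hpow : (0 : ℝ) < 3 ^ g := by positivity
    calc 1 / 9 * ((N : ℝ) * Real.log N)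
        ≤ 1 / 9 * (3 * 3 ^ g * (2 * Real.log A.card)) := by gcongr
      _ ≤ 3 ^ g * Real.log A.card := by
          have : 0 ≤ 3 ^ g * Real.log A.card := by
            have : 0 ≤ Real.log A.card := Real.log_nonneg (by linarith)
            positivity
          linarith
      _ ≤ 3 ^ g * harmonic (A.card - 1) := by gcongr
  · refine le_trans (RandomWalk.coverTime_le_of_hittingTime_le hh hE (by positivity) hM)
      (ENNReal.ofReal_le_ofReal ?_)
    have hharm : (harmonic (Fintype.card (Pseudofractal.Vertex g)) : ℝ) ≤ 2 * Real.log N := by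
      rw [← Nat.card_eq_fintype_card]
      have := harmonic_le_one_add_log N
      linarith
    calc 10 * 3 ^ g * (harmonic (Fintype.card (Pseudofractal.Vertex g)) : ℝ)
        ≤ 10 * 3 ^ g * (2 * Real.log N) := by gcongr
      _ ≤ 10 * N * (2 * Real.log N) := by gcongr
      _ = 20 * (N * Real.log N) := by ring
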